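/- Let $(X,d)$ be a compact ultrametric space, i.e. a compact metric space such that $d(x,z)\le\max(d(x,y),d(y,z))$ for all $x,y,z\in X$. Let $\mathscr P(X)$ be the set of Borel probability measures on $X$, and for $p\in[1,\infty)$ and $\mu,\nu\in\mathscr P(X)$ let $$W_p(\mu,\nu)=\Big(\inf_{\Pi}\int_{X\times X} d(a,b)^p\,\Pi(\mathrm da\,\mathrm db)\Big)^{1/p},$$ where $\Pi$ runs over the measures on $X\times X$ with first marginal $\mu$ and second marginal $\nu$. Write $\mathscr W_p(X)=(\mathscr P(X),W_p)$. For $\alpha>0$, an $\alpha$-Hölder arc in $\mathscr W_p(X)$ is a map $\gamma:[0,1]\to\mathscr P(X)$ for which there is a constant $C$ with $W_p(\gamma(s),\gamma(t))\le C|s-t|^\alpha$ for all $s,t\in[0,1]$. Then: 1. $\mathscr W_1(X)$ is a geodesic space: $W_1$ is a distance on $\mathscr P(X)$, and for all $\mu,\nu\in\mathscr P(X)$ there is $\gamma:[0,1]\to\mathscr P(X)$ with $\gamma(0)=\mu$, $\gamma(1)=\nu$ and $W_1(\gamma(s),\gamma(t))=|s-t|\,W_1(\mu,\nu)$ for all $s,t\in[0,1]$.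 2. For every real $p>1$, $W_p$ is a distance on $\mathscr P(X)$; any two $\mu,\nu\in\mathscr P(X)$ are joined by a $\frac1p$-Hölder arc $\gamma$ in $\mathscr W_p(X)$, $\gamma(0)=\mu$, $\gamma(1)=\nu$; and for every $\alpha>\frac1p$, every $\alpha$-Hölder arc in $\mathscr W_p(X)$ is constant. -/

import Mathlib

open MeasureTheory

/-- The transport plans (couplings) of `μ` and `ν`: the measures on `X × X` whose first and second
marginals are `μ` and `ν`. -/
def transportPlans {X : Type*} [MeasurableSpace X] (μ ν : ProbabilityMeasure X) :
    Set (Measure (X × X)) :=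
  {P | P.map Prod.fst = (μ : Measure X) ∧ P.map Prod.snd = (ν : Measure X)}

/-- The total cost `∫ d(a, b) ^ p dP(a, b)` of a transport plan. -/
noncomputable def transportCost {X : Type*} [MetricSpace X] [MeasurableSpace X]
    (p : ℝ) (P : Measure (X × X)) : ℝ :=
  ∫ z, dist z.1 z.2 ^ p ∂P

/-- The `L^p` Wasserstein distance between Borel probability measures on a compact metric space
(compactness makes every cost a convergent integral). -/
noncomputable def wassersteinDist {X : Type*} [MetricSpace X] [CompactSpace X]
    [MeasurableSpace X] [BorelSpace X] (p : ℝ) (μ ν : ProbabilityMeasure X) : ℝ :=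
  (sInf (transportCost p '' transportPlans μ ν)) ^ (1 / p)

/-- `D` is a distance on `M`: the axioms of a metric space. -/
structure IsDistance {M : Type*} (D : M → M → ℝ) : Prop where
  nonneg : ∀ x y, 0 ≤ D x y
  eq_zero_iff : ∀ x y, D x y = 0 ↔ x = y
  symm : ∀ x y, D x y = D y x
  triangle : ∀ x y z, D x z ≤ D x y + D y z

/-- `(M, D)` is a geodesic space: a metric space in which any two points are joined by a
constant speed geodesic `γ : [0,1] → M`. -/
def IsGeodesicSpace {M : Type*} (D : M → M → ℝ) : Prop :=
  IsDistance D ∧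
    ∀ x y : M, ∃ γ : unitInterval → M, γ 0 = x ∧ γ 1 = y ∧
      ∀ s t : unitInterval, D (γ s) (γ t) = |(s : ℝ) - (t : ℝ)| * D x y

/-- `γ : [0,1] → M` is an `α`-Hölder arc for the distance `D`. -/
def IsHolderArc {M : Type*} (D : M → M → ℝ) (α : ℝ) (γ : unitInterval → M) : Prop :=
  ∃ C : ℝ, ∀ s t : unitInterval, D (γ s) (γ t) ≤ C * |(s : ℝ) - (t : ℝ)| ^ α

open scoped ENNReal

/-! ### Transport plans and gluing -/

section Plans

variable {X : Type*} [MeasurableSpace X] {μ ν ρ : ProbabilityMeasure X} {P Q : Measure (X × X)}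

/-! In an ultrametric space `d ^ p` still satisfies the triangle inequality, so the optimal cost
`W_p ^ p` is itself a distance: gluing gives its triangle inequality, Markov's inequality its
separation of points. Along the segment `(1 - t) μ + t ν` only the mass `|t - s|` moves, so the cost
is at most `|t - s|` times that between `μ` and `ν`. For `p = 1` the triangle inequality turns this
bound into an equality, which gives geodesics; for `p > 1` its `p`-th root is the `1/p`-Hölder
bound. Conversely, an `α`-Hölder arc for `W_p` is `αp`-Hölder for the cost. If `αp > 1`, fine
subdivision makes the cost between any two of its points vanish (`eq_zero_of_le_mul_rpow`). -/

theorem isProbabilityMeasure_of_mem_transportPlans (hP : P ∈ transportPlans μ ν) :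
    IsProbabilityMeasure P := by
  have h : IsProbabilityMeasure (P.map Prod.fst) := by rw [hP.1]; infer_instance
  exact Measure.isProbabilityMeasure_of_map Prod.fst

theorem prod_mem_transportPlans (μ ν : ProbabilityMeasure X) :
    (μ : Measure X).prod (ν : Measure X) ∈ transportPlans μ ν := by
  constructor <;> simp

theorem transportPlans_nonempty (μ ν : ProbabilityMeasure X) : (transportPlans μ ν).Nonempty :=
  ⟨_, prod_mem_transportPlans μ ν⟩

theorem map_swap_mem_transportPlans (hP : P ∈ transportPlans μ ν) :
    P.map Prod.swap ∈ transportPlans ν μ := by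
  constructor
  · rw [Measure.map_map measurable_fst measurable_swap]
    exact hP.2
  · rw [Measure.map_map measurable_snd measurable_swap]
    exact hP.1

/-- The plan that leaves every point where it is. -/
theorem map_diag_mem_transportPlans (μ : ProbabilityMeasure X) :
    (μ : Measure X).map (fun x => (x, x)) ∈ transportPlans μ μ := by
  constructor
  · rw [Measure.map_map measurable_fst (by fun_prop)]
    exact Measure.map_id
  · rw [Measure.map_map measurable_snd (by fun_prop)]
    exact Measure.map_id

/-- The gluing lemma. -/
theorem exists_gluing [StandardBorelSpace X] (hP : P ∈ transportPlans μ ν)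
    (hQ : Q ∈ transportPlans ν ρ) :
    ∃ R : Measure ((X × X) × X), IsProbabilityMeasure R ∧ R.map Prod.fst = P ∧
      R.map (fun z => (z.1.2, z.2)) = Q := by
  have := isProbabilityMeasure_of_mem_transportPlans hP
  have := isProbabilityMeasure_of_mem_transportPlans hQ
  have : Nonempty X := (ν : Measure X).nonempty_of_neZero
  -- The third point is drawn from the conditional law of `Q` given the middle point alone.
  let κ : ProbabilityTheory.Kernel (X × X) X := Q.condKernel.comap Prod.snd measurable_snd
  refine ⟨P.compProd κ, inferInstance, Measure.fst_compProd P κ, ?_⟩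
  have hQ' : (P.map Prod.snd).compProd Q.condKernel = Q := by
    rw [hP.2, ← hQ.1]
    exact Q.disintegrate Q.condKernel
  conv_rhs => rw [← hQ']
  ext s hs
  rw [Measure.map_apply (by fun_prop) hs, Measure.compProd_apply (hs.preimage (by fun_prop)),
    Measure.compProd_apply hs,
    lintegral_map (ProbabilityTheory.Kernel.measurable_kernel_prodMk_left hs) measurable_snd]
  rfl

end Plans

/-! ### Linear interpolation of measures -/

section Interpolation

variable {X : Type*} [MeasurableSpace X]

/-- The segment `(1 - t) μ + t ν`. -/
noncomputable def segmentMeasure (μ ν : ProbabilityMeasure X) (t : unitInterval) :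
    ProbabilityMeasure X :=
  ⟨ENNReal.ofReal (1 - t) • (μ : Measure X) + ENNReal.ofReal t • (ν : Measure X), ⟨by
    simp [← ENNReal.ofReal_add (sub_nonneg.2 t.2.2) t.2.1]⟩⟩

theorem coe_segmentMeasure (μ ν : ProbabilityMeasure X) (t : unitInterval) :
    (segmentMeasure μ ν t : Measure X) =
      ENNReal.ofReal (1 - t) • (μ : Measure X) + ENNReal.ofReal t • (ν : Measure X) := rfl

theorem segmentMeasure_zero (μ ν : ProbabilityMeasure X) : segmentMeasure μ ν 0 = μ := by
  apply ProbabilityMeasure.toMeasure_injective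
  simp [coe_segmentMeasure]

theorem segmentMeasure_one (μ ν : ProbabilityMeasure X) : segmentMeasure μ ν 1 = ν := by
  apply ProbabilityMeasure.toMeasure_injective
  simp [coe_segmentMeasure]

/-- Along a segment, only the mass `t - s` has to be moved. -/
theorem segment_mem_transportPlans {μ ν : ProbabilityMeasure X} {P : Measure (X × X)}
    (hP : P ∈ transportPlans μ ν) {s t : unitInterval} (hst : s ≤ t) :
    ENNReal.ofReal (1 - t) • (μ : Measure X).map (fun x => (x, x)) +
      ENNReal.ofReal s • (ν : Measure X).map (fun x => (x, x)) + ENNReal.ofReal (t - s) • P ∈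
      transportPlans (segmentMeasure μ ν s) (segmentMeasure μ ν t) := by
  have hst' : (0 : ℝ) ≤ t - s := sub_nonneg.2 hst
  have hμ := map_diag_mem_transportPlans μ
  have hν := map_diag_mem_transportPlans ν
  constructor
  · rw [Measure.map_add _ _ measurable_fst, Measure.map_add _ _ measurable_fst, Measure.map_smul,
      Measure.map_smul, Measure.map_smul, hμ.1, hν.1, hP.1, coe_segmentMeasure, add_right_comm,
      ← add_smul, ← ENNReal.ofReal_add (sub_nonneg.2 t.2.2) hst']
    congr 3
    ring
  · rw [Measure.map_add _ _ measurable_snd, Measure.map_add _ _ measurable_snd, Measure.map_smul,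
      Measure.map_smul, Measure.map_smul, hμ.2, hν.2, hP.2, coe_segmentMeasure, add_assoc,
      ← add_smul, ← ENNReal.ofReal_add s.2.1 hst']
    congr 3
    ring

end Interpolation

/-! ### The optimal cost as a distance -/

section Cost

theorem continuous_dist_rpow {X : Type*} [MetricSpace X] {p : ℝ} (hp : 0 < p) :
    Continuous fun z : X × X => dist z.1 z.2 ^ p :=
  continuous_dist.rpow_const fun _ => Or.inr hp.le

/-- One of the two right-hand distances already dominates `dist x z`. For `p > 1` this fails in
general metric spaces; the ultrametric hypothesis enters the proof here. -/
theorem dist_rpow_triangle {X : Type*} [MetricSpace X] [IsUltrametricDist X] {p : ℝ} (hp : 0 < p)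
    (x y z : X) :
    dist x z ^ p ≤ dist x y ^ p + dist y z ^ p := by
  have hx := Real.rpow_nonneg (dist_nonneg (x := x) (y := y)) p
  have hz := Real.rpow_nonneg (dist_nonneg (x := y) (y := z)) p
  rcases le_max_iff.1 (dist_triangle_max x y z) with h | h
  · linarith [Real.rpow_le_rpow dist_nonneg h hp.le]
  · linarith [Real.rpow_le_rpow dist_nonneg h hp.le]

variable {X : Type*} [MetricSpace X] [MeasurableSpace X] {p : ℝ}

theorem transportCost_nonneg (p : ℝ) (P : Measure (X × X)) : 0 ≤ transportCost p P :=
  integral_nonneg fun _ => Real.rpow_nonneg dist_nonneg _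

theorem bddBelow_transportCost (p : ℝ) (μ ν : ProbabilityMeasure X) :
    BddBelow (transportCost p '' transportPlans μ ν) :=
  ⟨0, by rintro _ ⟨P, -, rfl⟩; exact transportCost_nonneg p P⟩

/-- The optimal cost, that is the `p`-th power of the Wasserstein distance. -/
noncomputable def optimalCost (p : ℝ) (μ ν : ProbabilityMeasure X) : ℝ :=
  sInf (transportCost p '' transportPlans μ ν)

theorem optimalCost_nonneg (p : ℝ) (μ ν : ProbabilityMeasure X) : 0 ≤ optimalCost p μ ν :=
  Real.sInf_nonneg (by rintro _ ⟨P, -, rfl⟩; exact transportCost_nonneg p P)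

theorem optimalCost_le {μ ν : ProbabilityMeasure X} {P : Measure (X × X)}
    (hP : P ∈ transportPlans μ ν) : optimalCost p μ ν ≤ transportCost p P :=
  csInf_le (bddBelow_transportCost p μ ν) ⟨P, hP, rfl⟩

theorem exists_transportCost_lt {μ ν : ProbabilityMeasure X} {c : ℝ}
    (hc : optimalCost p μ ν < c) : ∃ P ∈ transportPlans μ ν, transportCost p P < c := by
  obtain ⟨_, ⟨P, hP, rfl⟩, h⟩ :=
    exists_lt_of_csInf_lt ((transportPlans_nonempty μ ν).image _) hc
  exact ⟨P, hP, h⟩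

variable [CompactSpace X] [BorelSpace X]

theorem integrable_dist_rpow (hp : 0 < p) (P : Measure (X × X)) [IsFiniteMeasure P] :
    Integrable (fun z : X × X => dist z.1 z.2 ^ p) P :=
  (continuous_dist_rpow hp).integrable_of_hasCompactSupport (HasCompactSupport.of_compactSpace _)

theorem transportCost_map_swap (hp : 0 < p) (P : Measure (X × X)) :
    transportCost p (P.map Prod.swap) = transportCost p P := by
  rw [transportCost, integral_map measurable_swap.aemeasurable
    (continuous_dist_rpow hp).aestronglyMeasurable]
  simp only [Prod.fst_swap, Prod.snd_swap, dist_comm]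
  rfl

theorem transportCost_map_diag (hp : 0 < p) (μ : Measure X) :
    transportCost p (μ.map fun x => (x, x)) = 0 := by
  rw [transportCost, integral_map (by fun_prop) (continuous_dist_rpow hp).aestronglyMeasurable]
  simp [Real.zero_rpow hp.ne']

theorem optimalCost_self (hp : 0 < p) (μ : ProbabilityMeasure X) : optimalCost p μ μ = 0 :=
  le_antisymm ((optimalCost_le (map_diag_mem_transportPlans μ)).trans_eq
    (transportCost_map_diag hp _)) (optimalCost_nonneg p μ μ)

theorem optimalCost_comm (hp : 0 < p) (μ ν : ProbabilityMeasure X) :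
    optimalCost p μ ν = optimalCost p ν μ := by
  have key : ∀ μ ν : ProbabilityMeasure X, optimalCost p μ ν ≤ optimalCost p ν μ := by
    intro μ ν
    refine le_csInf ((transportPlans_nonempty ν μ).image _) ?_
    rintro _ ⟨P, hP, rfl⟩
    exact (optimalCost_le (map_swap_mem_transportPlans hP)).trans_eq (transportCost_map_swap hp P)
  exact le_antisymm (key μ ν) (key ν μ)

/-- Markov's inequality for a transport plan. -/
theorem measure_le_measure_thickening_add {μ ν : ProbabilityMeasure X} {P : Measure (X × X)}
    (hp : 0 < p) (hP : P ∈ transportPlans μ ν) {r : ℝ} (hr : 0 < r)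
    (hcost : transportCost p P ≤ r ^ p * r) {B : Set X} (hB : MeasurableSet B) :
    (μ : Measure X) B ≤ (ν : Measure X) (Metric.thickening r B) + ENNReal.ofReal r := by
  have := isProbabilityMeasure_of_mem_transportPlans hP
  -- Dividing the cost bound `r ^ p * r` by the threshold `r ^ p` leaves `r`: the same number bounds
  -- displacement and exceptional mass, as in the Lévy–Prokhorov distance.
  have hmarkov : P {z | r ^ p ≤ dist z.1 z.2 ^ p} ≤ ENNReal.ofReal r := by
    have h := mul_meas_ge_le_integral_of_nonneg (μ := P)
      (f := fun z : X × X => dist z.1 z.2 ^ p)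
      (Filter.Eventually.of_forall fun _ => Real.rpow_nonneg dist_nonneg _)
      (integrable_dist_rpow hp P) (r ^ p)
    have h' := le_of_mul_le_mul_left (h.trans hcost) (Real.rpow_pos_of_pos hr p)
    rw [← ofReal_measureReal]
    exact ENNReal.ofReal_le_ofReal h'
  rw [← hP.1, ← hP.2, Measure.map_apply measurable_fst hB,
    Measure.map_apply measurable_snd Metric.isOpen_thickening.measurableSet]
  refine (measure_mono fun z hz => ?_).trans
    ((measure_union_le _ _).trans (add_le_add_right hmarkov _))
  by_cases h : dist z.1 z.2 < r
  · exact Or.inl (Metric.mem_thickening_iff.2 ⟨z.1, hz, by rwa [dist_comm]⟩)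
  · exact Or.inr (Real.rpow_le_rpow hr.le (not_lt.1 h) hp.le)

/-- Plans of arbitrarily small cost make the Lévy–Prokhorov distance vanish, and that distance
separates Borel probability measures. -/
theorem eq_of_optimalCost_eq_zero (hp : 0 < p) {μ ν : ProbabilityMeasure X}
    (h : optimalCost p μ ν = 0) : μ = ν := by
  have hle : ∀ μ ν : ProbabilityMeasure X, optimalCost p μ ν = 0 → ∀ (ε : ℝ≥0∞) (B : Set X),
      0 < ε → ε < ∞ → MeasurableSet B →
        (μ : Measure X) B ≤ (ν : Measure X) (Metric.thickening ε.toReal B) + ε := by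
    intro μ ν h ε B hε hε' hB
    have hr : 0 < ε.toReal := ENNReal.toReal_pos hε.ne' hε'.ne
    obtain ⟨P, hP, hc⟩ := exists_transportCost_lt (p := p) (μ := μ) (ν := ν)
      (c := ε.toReal ^ p * ε.toReal) (by rw [h]; positivity)
    simpa [ENNReal.ofReal_toReal hε'.ne] using
      measure_le_measure_thickening_add hp hP hr hc.le hB
  have hLP : levyProkhorovEDist (μ : Measure X) ν = 0 :=
    nonpos_iff_eq_zero.1 <| levyProkhorovEDist_le_of_forall _ _ 0 fun ε B hε hε' hB =>
      ⟨hle μ ν h ε B hε hε' hB, hle ν μ (by rwa [optimalCost_comm hp]) ε B hε hε' hB⟩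
  have : LevyProkhorov.ofMeasure μ = LevyProkhorov.ofMeasure ν := by
    apply eq_of_dist_eq_zero
    simp [LevyProkhorov.dist_probabilityMeasure_def, levyProkhorovDist, hLP]
  exact congrArg LevyProkhorov.toMeasure this

theorem optimalCost_segmentMeasure_le (hp : 0 < p) (μ ν : ProbabilityMeasure X)
    (s t : unitInterval) :
    optimalCost p (segmentMeasure μ ν s) (segmentMeasure μ ν t) ≤
      |(s : ℝ) - t| * optimalCost p μ ν := by
  wlog hst : s ≤ t generalizing s t
  · rw [optimalCost_comm hp, abs_sub_comm]
    exact this t s (le_of_not_ge hst)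
  have hst' : (0 : ℝ) ≤ t - s := sub_nonneg.2 hst
  rw [abs_sub_comm, abs_of_nonneg hst']
  refine le_of_forall_pos_le_add fun ε hε => ?_
  obtain ⟨P, hP, hc⟩ := exists_transportCost_lt (lt_add_of_pos_right (optimalCost p μ ν) hε)
  have := isProbabilityMeasure_of_mem_transportPlans hP
  have := isProbabilityMeasure_of_mem_transportPlans (map_diag_mem_transportPlans μ)
  have := isProbabilityMeasure_of_mem_transportPlans (map_diag_mem_transportPlans ν)
  have hI := fun (Q : Measure (X × X)) [IsProbabilityMeasure Q] (c : ℝ) =>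
    (integrable_dist_rpow hp Q).smul_measure (c := ENNReal.ofReal c) ENNReal.ofReal_ne_top
  have hcost : optimalCost p (segmentMeasure μ ν s) (segmentMeasure μ ν t) ≤
      (t - s) * transportCost p P := by
    refine (optimalCost_le (segment_mem_transportPlans hP hst)).trans_eq ?_
    have hμ := transportCost_map_diag hp (μ : Measure X)
    have hν := transportCost_map_diag hp (ν : Measure X)
    rw [transportCost] at hμ hν
    rw [transportCost, integral_add_measure ((hI _ _).add_measure (hI _ _)) (hI _ _),
      integral_add_measure (hI _ _) (hI _ _), integral_smul_measure, integral_smul_measure,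
      integral_smul_measure, hμ, hν, ENNReal.toReal_ofReal hst']
    simp [transportCost]
  -- Ensures that the error `(t - s) * ε` is at most `ε`.
  have h1 : (t : ℝ) - s ≤ 1 := by linarith [t.2.2, s.2.1]
  nlinarith [mul_le_mul_of_nonneg_left hc.le hst']

variable [IsUltrametricDist X]

/-- Near-optimal plans are glued along `ν` and `dist_rpow_triangle` is integrated; no Minkowski
inequality is needed, so no root is taken. -/
theorem optimalCost_triangle (hp : 0 < p) (μ ν ρ : ProbabilityMeasure X) :
    optimalCost p μ ρ ≤ optimalCost p μ ν + optimalCost p ν ρ := by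
  refine le_of_forall_pos_le_add fun ε hε => ?_
  obtain ⟨P, hP, hPc⟩ :=
    exists_transportCost_lt (lt_add_of_pos_right (optimalCost p μ ν) (half_pos hε))
  obtain ⟨Q, hQ, hQc⟩ :=
    exists_transportCost_lt (lt_add_of_pos_right (optimalCost p ν ρ) (half_pos hε))
  obtain ⟨R, hR, hRP, hRQ⟩ := exists_gluing hP hQ
  have hmP : Measurable fun z : (X × X) × X => z.1 := measurable_fst
  have hmQ : Measurable fun z : (X × X) × X => (z.1.2, z.2) := by fun_prop
  have hmS : Measurable fun z : (X × X) × X => (z.1.1, z.2) := by fun_prop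
  have hS : R.map (fun z => (z.1.1, z.2)) ∈ transportPlans μ ρ := by
    constructor
    · rw [← hP.1, ← hRP, Measure.map_map measurable_fst hmS, Measure.map_map measurable_fst hmP]
      rfl
    · rw [← hQ.2, ← hRQ, Measure.map_map measurable_snd hmS, Measure.map_map measurable_snd hmQ]
      rfl
  have hcost : ∀ {f : (X × X) × X → X × X}, Measurable f →
      transportCost p (R.map f) = ∫ z, dist (f z).1 (f z).2 ^ p ∂(R) := fun hf =>
    integral_map hf.aemeasurable (continuous_dist_rpow hp).aestronglyMeasurable
  have hint : ∀ {f : (X × X) × X → X × X}, Continuous f →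
      Integrable (fun z => dist (f z).1 (f z).2 ^ p) R := fun hf =>
    ((continuous_dist_rpow hp).comp hf).integrable_of_hasCompactSupport
      (HasCompactSupport.of_compactSpace _)
  have hle : transportCost p (R.map fun z => (z.1.1, z.2)) ≤
      transportCost p P + transportCost p Q := by
    rw [← hRP, ← hRQ, hcost hmS, hcost hmP, hcost hmQ,
      ← integral_add (hint (f := fun z => z.1) (by fun_prop))
        (hint (f := fun z => (z.1.2, z.2)) (by fun_prop))]
    exact integral_mono (hint (f := fun z => (z.1.1, z.2)) (by fun_prop))
      ((hint (f := fun z => z.1) (by fun_prop)).add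
        (hint (f := fun z => (z.1.2, z.2)) (by fun_prop)))
      fun z => dist_rpow_triangle hp _ _ _
  linarith [optimalCost_le (p := p) hS]

end Cost

/-! ### Wasserstein distances and segments -/

section Wasserstein

variable {X : Type*} [MetricSpace X] [CompactSpace X] [MeasurableSpace X] [BorelSpace X] {p : ℝ}

theorem wassersteinDist_eq (p : ℝ) (μ ν : ProbabilityMeasure X) :
    wassersteinDist p μ ν = optimalCost p μ ν ^ (1 / p) := rfl

theorem wassersteinDist_nonneg (p : ℝ) (μ ν : ProbabilityMeasure X) :
    0 ≤ wassersteinDist p μ ν :=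
  Real.rpow_nonneg (optimalCost_nonneg p μ ν) _

theorem wassersteinDist_rpow (hp : 0 < p) (μ ν : ProbabilityMeasure X) :
    wassersteinDist p μ ν ^ p = optimalCost p μ ν := by
  rw [wassersteinDist_eq, one_div, Real.rpow_inv_rpow (optimalCost_nonneg p μ ν) hp.ne']

theorem isHolderArc_segmentMeasure (hp : 0 < p) (μ ν : ProbabilityMeasure X) :
    IsHolderArc (wassersteinDist p) (1 / p) (segmentMeasure μ ν) := by
  refine ⟨wassersteinDist p μ ν, fun s t => ?_⟩
  rw [wassersteinDist_eq, wassersteinDist_eq, mul_comm,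
    ← Real.mul_rpow (abs_nonneg _) (optimalCost_nonneg p μ ν)]
  exact Real.rpow_le_rpow (optimalCost_nonneg _ _ _) (optimalCost_segmentMeasure_le hp μ ν s t)
    (by positivity)

variable [IsUltrametricDist X]

theorem isDistance_wassersteinDist (hp : 1 ≤ p) :
    IsDistance (wassersteinDist (X := X) p) where
  nonneg := wassersteinDist_nonneg p
  eq_zero_iff μ ν := by
    have hp0 : 0 < p := by linarith
    rw [wassersteinDist_eq, Real.rpow_eq_zero (optimalCost_nonneg p μ ν) (by positivity)]
    exact ⟨eq_of_optimalCost_eq_zero hp0, fun h => h ▸ optimalCost_self hp0 μ⟩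
  symm μ ν := by
    rw [wassersteinDist_eq, wassersteinDist_eq, optimalCost_comm (by linarith)]
  triangle μ ν ρ := by
    have hp0 : 0 < p := by linarith
    refine (Real.rpow_le_rpow (optimalCost_nonneg _ _ _) (optimalCost_triangle hp0 μ ν ρ)
      (by positivity)).trans ?_
    -- Since `1 / p ≤ 1`, the root is subadditive.
    exact Real.rpow_add_le_add_rpow (optimalCost_nonneg _ _ _) (optimalCost_nonneg _ _ _)
      (by positivity) ((div_le_one hp0).2 hp)

/-- The upper bounds over `[0, s]`, `[s, t]` and `[t, 1]` add up to `W_1(μ, ν)`, so the triangle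
inequality leaves no slack in any of them. -/
theorem wassersteinDist_one_segmentMeasure (μ ν : ProbabilityMeasure X) (s t : unitInterval) :
    wassersteinDist 1 (segmentMeasure μ ν s) (segmentMeasure μ ν t) =
      |(s : ℝ) - t| * wassersteinDist 1 μ ν := by
  have hD := isDistance_wassersteinDist (X := X) le_rfl
  wlog hst : s ≤ t generalizing s t
  · rw [hD.symm, abs_sub_comm]
    exact this t s (le_of_not_ge hst)
  have hle : ∀ s t : unitInterval,
      wassersteinDist 1 (segmentMeasure μ ν s) (segmentMeasure μ ν t) ≤
        |(s : ℝ) - t| * wassersteinDist 1 μ ν := by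
    simpa [wassersteinDist_eq] using optimalCost_segmentMeasure_le one_pos μ ν
  refine le_antisymm (hle s t) ?_
  have h0 := hle 0 s
  have h1 := hle t 1
  rw [segmentMeasure_zero, abs_sub_comm, Set.Icc.coe_zero, sub_zero,
    abs_of_nonneg s.2.1] at h0
  rw [segmentMeasure_one, abs_sub_comm, Set.Icc.coe_one,
    abs_of_nonneg (sub_nonneg.2 t.2.2)] at h1
  have hst' : (0 : ℝ) ≤ t - s := sub_nonneg.2 hst
  rw [abs_sub_comm, abs_of_nonneg hst']
  linarith [hD.triangle μ (segmentMeasure μ ν s) ν,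
    hD.triangle (segmentMeasure μ ν s) (segmentMeasure μ ν t) ν]

theorem isGeodesicSpace_wassersteinDist_one : IsGeodesicSpace (wassersteinDist (X := X) 1) :=
  ⟨isDistance_wassersteinDist le_rfl, fun μ ν => ⟨segmentMeasure μ ν, segmentMeasure_zero μ ν,
    segmentMeasure_one μ ν, wassersteinDist_one_segmentMeasure μ ν⟩⟩

end Wasserstein

/-- A Hölder arc of exponent larger than `1` is constant. -/
theorem eq_zero_of_le_mul_rpow {M : Type*} {K : M → M → ℝ} (hnonneg : ∀ x y, 0 ≤ K x y)
    (hself : ∀ x, K x x = 0) (htri : ∀ x y z, K x z ≤ K x y + K y z) {γ : unitInterval → M}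
    {C β : ℝ} (hβ : 1 < β) (hγ : ∀ s t : unitInterval, K (γ s) (γ t) ≤ C * |(s : ℝ) - t| ^ β)
    (s t : unitInterval) : K (γ s) (γ t) = 0 := by
  refine le_antisymm ?_ (hnonneg _ _)
  -- With `N = n + 1` equal steps, each costs at most `C * (|s - t| / N) ^ β`; the total carries the
  -- factor `N ^ (1 - β)`, which tends to `0`.
  have hbound : ∀ n : ℕ, K (γ s) (γ t) ≤
      C * |(s : ℝ) - t| ^ β * ((n + 1 : ℕ) : ℝ) ^ (-(β - 1)) := by
    intro n
    have hN : (0 : ℝ) < (n + 1 : ℕ) := by positivity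
    -- The projection only makes `u` total: for `k ≤ n + 1` the point already lies in `[0, 1]`.
    let u : ℕ → unitInterval := fun k =>
      Set.projIcc 0 1 zero_le_one ((s : ℝ) + k / (n + 1 : ℕ) * (t - s))
    have hu : ∀ k ≤ n + 1, (u k : ℝ) = s + k / (n + 1 : ℕ) * (t - s) := by
      intro k hk
      have h0 : (0 : ℝ) ≤ k / (n + 1 : ℕ) := by positivity
      have h1 : (k : ℝ) / (n + 1 : ℕ) ≤ 1 := (div_le_one hN).2 (by exact_mod_cast hk)
      have hs := s.2
      have ht := t.2
      have hmem : (s : ℝ) + k / (n + 1 : ℕ) * (t - s) ∈ Set.Icc (0 : ℝ) 1 := by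
        constructor <;> nlinarith [hs.1, hs.2, ht.1, ht.2]
      simp only [u, Set.projIcc_of_mem _ hmem]
    have hsum : ∀ k ≤ n + 1, K (γ s) (γ (u k)) ≤ k * (C * (|(s : ℝ) - t| / (n + 1 : ℕ)) ^ β) := by
      intro k
      induction k with
      | zero =>
        intro _
        have : u 0 = s := Subtype.ext (by simp [hu 0 (Nat.zero_le _)])
        simp [this, hself]
      | succ k ih =>
        intro hk
        have hstep := hγ (u k) (u (k + 1))
        have habs : |(u k : ℝ) - u (k + 1)| = |(s : ℝ) - t| / (n + 1 : ℕ) := by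
          rw [hu k (by omega), hu (k + 1) hk, ← abs_of_pos hN, ← abs_div, abs_of_pos hN]
          congr 1
          push_cast
          field_simp
          ring
        rw [habs] at hstep
        have := htri (γ s) (γ (u k)) (γ (u (k + 1)))
        have := ih (by omega)
        rw [Nat.cast_succ k]
        linarith
    have hlast : u (n + 1) = t := Subtype.ext (by rw [hu _ le_rfl, div_self hN.ne']; ring)
    have h := hsum (n + 1) le_rfl
    rw [hlast, Real.div_rpow (abs_nonneg _) hN.le] at h
    refine h.trans_eq ?_
    rw [neg_sub, Real.rpow_sub hN, Real.rpow_one]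
    ring
  have hlim : Filter.Tendsto
      (fun n : ℕ => C * |(s : ℝ) - t| ^ β * ((n + 1 : ℕ) : ℝ) ^ (-(β - 1)))
      Filter.atTop (nhds (C * |(s : ℝ) - t| ^ β * 0)) :=
    (((tendsto_rpow_neg_atTop (sub_pos.2 hβ)).comp tendsto_natCast_atTop_atTop).comp
      (Filter.tendsto_add_atTop_nat 1)).const_mul _
  rw [mul_zero] at hlim
  exact ge_of_tendsto' hlim hbound

theorem eq_of_isHolderArc_wassersteinDist {X : Type*} [MetricSpace X] [CompactSpace X]
    [IsUltrametricDist X] [MeasurableSpace X] [BorelSpace X] {p α : ℝ} (hp : 0 < p)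
    (hα : 1 / p < α) {γ : unitInterval → ProbabilityMeasure X}
    (hγ : IsHolderArc (wassersteinDist p) α γ) (s t : unitInterval) : γ s = γ t := by
  obtain ⟨C, hC⟩ := hγ
  -- The Hölder bound is raised to the power `p`; `|C|` replaces `C`, whose sign is unknown.
  refine eq_of_optimalCost_eq_zero hp (eq_zero_of_le_mul_rpow (C := |C| ^ p) (β := α * p)
    (optimalCost_nonneg p) (optimalCost_self hp) (optimalCost_triangle hp)
    ((div_lt_iff₀ hp).1 hα) (fun s t => ?_) s t)
  rw [← wassersteinDist_rpow hp, Real.rpow_mul (abs_nonneg _),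
    ← Real.mul_rpow (abs_nonneg _) (Real.rpow_nonneg (abs_nonneg _) _)]
  exact Real.rpow_le_rpow (wassersteinDist_nonneg p _ _) ((hC s t).trans
    (mul_le_mul_of_nonneg_right (le_abs_self C) (Real.rpow_nonneg (abs_nonneg _) _))) hp.le

theorem mainTheorem2 {X : Type*} [MetricSpace X] [CompactSpace X] [IsUltrametricDist X]
    [MeasurableSpace X] [BorelSpace X] :
    IsGeodesicSpace (wassersteinDist (X := X) 1) ∧
    ∀ p : ℝ, 1 < p →
      IsDistance (wassersteinDist (X := X) p) ∧
      (∀ μ ν : ProbabilityMeasure X, ∃ γ : unitInterval → ProbabilityMeasure X,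
        IsHolderArc (wassersteinDist p) (1 / p) γ ∧ γ 0 = μ ∧ γ 1 = ν) ∧
      (∀ α : ℝ, 1 / p < α → ∀ γ : unitInterval → ProbabilityMeasure X,
        IsHolderArc (wassersteinDist p) α γ → ∀ s t : unitInterval, γ s = γ t) := by
  refine ⟨isGeodesicSpace_wassersteinDist_one, fun p hp => ⟨isDistance_wassersteinDist hp.le,
    fun μ ν => ⟨segmentMeasure μ ν, isHolderArc_segmentMeasure (by linarith) μ ν,
      segmentMeasure_zero μ ν, segmentMeasure_one μ ν⟩,
    fun α hα γ hγ => eq_of_isHolderArc_wassersteinDist (by linarith) hα hγ⟩⟩
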